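/- Fix a first-order vocabulary $L$ (with equality). Variables come from a countably infinite set, and models are $L$-structures with non-empty domain. A team of a model $M$ is a set $X$ of assignments $s:\mathrm{dom}(X)\to M$ with a common finite domain $\mathrm{dom}(X)$ of variables. Write $s(a/x)$ for the assignment with domain $\mathrm{dom}(s)\cup\{x\}$ that maps $x$ to $a$ and agrees with $s$ elsewhere, $X(F/x)=\{s(F(s)/x): s\in X\}$ for $F:X\to M$, and $X(M/x)=\{s(a/x): s\in X,\ a\in M\}$. Formulas of dependence logic $\mathbf{D}$ are given by $$\phi::=\alpha\mid\neg\alpha\mid {=}(t_1,\dots,t_n)\mid \neg{=}(t_1,\dots,t_n)\mid \phi\wedge\phi\mid\phi\otimes\phi\mid\forall x\,\phi\mid\exists x\,\phi ,$$ and formulas of intuitionistic dependence logic $\mathbf{ID}$ by $$\phi::=\alpha\mid {=}(t)\mid\bot\mid\phi\wedge\phi\mid\phi\vee\phi\mid\phi\to\phi\mid\forall x\,\phi\mid\exists x\,\phi ,$$ where $\alpha$ is a first-order atomic formula, $t,t_1,\dots,t_n$ are $L$-terms and $n\ge 1$. All variables in the terms of a dependence atom count as free in it; a sentence is a formula without free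 variables. For a team $X$ of $M$ whose domain contains the free variables of the formula, satisfaction is defined as follows: - $M\models_X\alpha$ (resp. $\neg\alpha$) iff every $s\in X$ satisfies $\alpha$ (resp. does not satisfy $\alpha$) in the sense of Tarski; - $M\models_X{=}(t_1,\dots,t_n)$ iff for all $s,s'\in X$ with $s(t_i)=s'(t_i)$ for all $i<n$, also $s(t_n)=s'(t_n)$; - $M\models_X\neg{=}(t_1,\dots,t_n)$ iff $X=\emptyset$; $M\models_X\bot$ iff $X=\emptyset$; - $M\models_X\phi\wedge\psi$ iff $M\models_X\phi$ and $M\models_X\psi$; $M\models_X\phi\vee\psi$ iff $M\models_X\phi$ or $M\models_X\psi$; - $M\models_X\phi\otimes\psi$ iff $X=Y\cup Z$ for some $Y,Z$ with $M\models_Y\phi$ and $M\models_Z\psi$; - $M\models_X\phi\to\psi$ iff for all $Y\subseteq X$, $M\models_Y\phi$ implies $M\models_Y\psi$; - $M\models_X\exists x\,\phi$ iff $M\models_{X(F/x)}\phi$ for some $F:X\to M$; $M\models_X\forall x\,\phi$ iff $M\models_{X(M/x)}\phi$. **Theorem.** Every $\mathbf{D}$ sentence is expressible in $\mathbf{ID}$: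 for every $\mathbf{D}$ sentence $\phi$ there is an $\mathbf{ID}$ sentence $\psi$ over the same vocabulary that is logically equivalent to $\phi$, i.e. for every model $M$ and every team $X$ of $M$ (with any finite domain), $M\models_X\phi$ if and only if $M\models_X\psi$. In particular $M\models_{\{\emptyset\}}\phi$ if and only if $M\models_{\{\emptyset\}}\psi$, where $\emptyset$ is the empty assignment. -/

import Mathlib

universe u v w

namespace BID



/-- First-order atomic formulas over `L`, with variables from the countably infinite set `ℕ`:
identities and relational atoms. -/
inductive Atom (L : FirstOrder.Language.{u, v}) : Type (max u v)
  | eq (t₁ t₂ : L.Term ℕ) : Atom L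
  | rel {n : ℕ} (R : L.Relations n) (ts : Fin n → L.Term ℕ) : Atom L

/-- Formulas of BID-logic, in negation normal form. The dependence atom `=(t₁, …, tₙ)`, `n ≥ 1`,
is `dep [t₁, …, tₙ₋₁] tₙ`, so the constancy atom `=(t)` is `dep [] t`. -/
inductive Form (L : FirstOrder.Language.{u, v}) : Type (max u v)
  | atom (α : Atom L) : Form L
  | natom (α : Atom L) : Form L
  | dep (ts : List (L.Term ℕ)) (t : L.Term ℕ) : Form L
  | ndep (ts : List (L.Term ℕ)) (t : L.Term ℕ) : Form L
  | bot : Form L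
  | conj (φ ψ : Form L) : Form L
  | split (φ ψ : Form L) : Form L
  | idisj (φ ψ : Form L) : Form L
  | imp (φ ψ : Form L) : Form L
  | limp (φ ψ : Form L) : Form L
  | all (x : ℕ) (φ : Form L) : Form L
  | ex (x : ℕ) (φ : Form L) : Form L

variable {L : FirstOrder.Language.{u, v}}

/-- The variables that occur in an atomic formula. -/
def Atom.vars : Atom L → Finset ℕ
  | .eq t₁ t₂ => t₁.varFinset ∪ t₂.varFinset
  | .rel _ ts => Finset.univ.biUnion fun i => (ts i).varFinset

/-- The variables that occur in one of the terms of a list. -/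
def listVars : List (L.Term ℕ) → Finset ℕ
  | [] => ∅
  | t :: ts => t.varFinset ∪ listVars ts

/-- The free variables of a formula. -/
def Form.fv : Form L → Finset ℕ
  | .atom α => α.vars
  | .natom α => α.vars
  | .dep ts t => listVars ts ∪ t.varFinset
  | .ndep ts t => listVars ts ∪ t.varFinset
  | .bot => ∅
  | .conj φ ψ => φ.fv ∪ ψ.fv
  | .split φ ψ => φ.fv ∪ ψ.fv
  | .idisj φ ψ => φ.fv ∪ ψ.fv
  | .imp φ ψ => φ.fv ∪ ψ.fv
  | .limp φ ψ => φ.fv ∪ ψ.fv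
  | .all x φ => φ.fv.erase x
  | .ex x φ => φ.fv.erase x

/-- A sentence is a formula without free variables. -/
def Form.IsSentence (φ : Form L) : Prop := φ.fv = ∅

/-- The formulas of dependence logic **D**. -/
def Form.IsD : Form L → Prop
  | .atom _ => True
  | .natom _ => True
  | .dep _ _ => True
  | .ndep _ _ => True
  | .bot => False
  | .conj φ ψ => φ.IsD ∧ ψ.IsD
  | .split φ ψ => φ.IsD ∧ ψ.IsD
  | .idisj _ _ => False
  | .imp _ _ => False
  | .limp _ _ => False
  | .all _ φ => φ.IsD
  | .ex _ φ => φ.IsD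

/-- The formulas of intuitionistic dependence logic **ID**: first-order literals must be positive
and dependence atoms must have a single term. -/
def Form.IsID : Form L → Prop
  | .atom _ => True
  | .natom _ => False
  | .dep ts _ => ts = []
  | .ndep _ _ => False
  | .bot => True
  | .conj φ ψ => φ.IsID ∧ ψ.IsID
  | .split _ _ => False
  | .idisj φ ψ => φ.IsID ∧ ψ.IsID
  | .imp φ ψ => φ.IsID ∧ ψ.IsID
  | .limp _ _ => False
  | .all _ φ => φ.IsID
  | .ex _ φ => φ.IsID

/-- Assignments on `M` with domain the finite set `V` of variables. -/
abbrev Assignment (M : Type w) (V : Finset ℕ) : Type w := V → M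

/-- Teams of `M` with domain `V`: sets of assignments with domain `V`. -/
abbrev Team (M : Type w) (V : Finset ℕ) : Type w := Set (Assignment M V)

section Semantics

variable {M : Type w} {V : Finset ℕ}

/-- The assignment `s(a/x)`, with domain `V ∪ {x}`. -/
def Assignment.update (s : Assignment M V) (x : ℕ) (a : M) : Assignment M (insert x V) :=
  fun i => if h : i.1 = x then a else s ⟨i.1, Finset.mem_of_mem_insert_of_ne i.2 h⟩

/-- The supplement team `X(F/x)`. -/
def Team.supplement (X : Team M V) (x : ℕ) (F : X → M) : Team M (insert x V) :=
  Set.range fun s : X => Assignment.update s.1 x (F s)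

/-- The duplicate team `X(M/x)`. -/
def Team.duplicate (X : Team M V) (x : ℕ) : Team M (insert x V) :=
  {s' | ∃ s ∈ X, ∃ a : M, s' = Assignment.update s x a}

variable [L.Structure M] [Nonempty M]

/-- The value `s(t)` of a term `t`. Variables outside the domain of `s` get an arbitrary value;
this never matters, because satisfaction is only considered for teams whose domain contains the
free variables of the formula. -/
noncomputable def Assignment.val (s : Assignment M V) (t : L.Term ℕ) : M :=
  t.realize fun i => if h : i ∈ V then s ⟨i, h⟩ else Classical.arbitrary M

/-- Tarskian satisfaction of an atomic formula by an assignment. -/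
def Atom.Holds (s : Assignment M V) : Atom L → Prop
  | .eq t₁ t₂ => s.val t₁ = s.val t₂
  | .rel R ts => FirstOrder.Language.Structure.RelMap R fun i => s.val (ts i)

/-- Team semantics: `φ.Sat X` is `M ⊨_X φ`. -/
def Form.Sat : Form L → {V : Finset ℕ} → Team M V → Prop
  | .atom α, _, X => ∀ s ∈ X, α.Holds s
  | .natom α, _, X => ∀ s ∈ X, ¬ α.Holds s
  | .dep ts t, _, X => ∀ s ∈ X, ∀ s' ∈ X,
      (∀ r ∈ ts, s.val r = s'.val r) → s.val t = s'.val t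
  | .ndep _ _, _, X => X = ∅
  | .bot, _, X => X = ∅
  | .conj φ ψ, _, X => φ.Sat X ∧ ψ.Sat X
  | .split φ ψ, V, X => ∃ Y Z : Team M V, X = Y ∪ Z ∧ φ.Sat Y ∧ ψ.Sat Z
  | .idisj φ ψ, _, X => φ.Sat X ∨ ψ.Sat X
  | .imp φ ψ, V, X => ∀ Y : Team M V, Y ⊆ X → φ.Sat Y → ψ.Sat Y
  | .limp φ ψ, V, X => ∀ Y : Team M V, φ.Sat Y → ψ.Sat (X ∪ Y)
  | .all x φ, _, X => φ.Sat (Team.duplicate X x)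
  | .ex x φ, _, X => ∃ F : X → M, φ.Sat (Team.supplement X x F)

end Semantics

/-- Logical equivalence: `φ` and `ψ` are satisfied by the same teams, for all models with
non-empty domain and all teams whose domain contains the free variables of both formulas. -/
def LogEquiv (φ ψ : Form L) : Prop :=
  ∀ (M : Type w) [L.Structure M] [Nonempty M] (V : Finset ℕ), φ.fv ∪ ψ.fv ⊆ V →
    ∀ X : Team M V, φ.Sat X ↔ ψ.Sat X

end BID

/-! The translation goes by induction on the formula. Over singletons `α → ⊥` says that `α` fails,
and a dependence atom speaks of pairs of assignments, so it can be tested on two-element subteams by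
constancy atoms. The real case is `φ ⊗ ψ`: with fresh `x`, `y`, each assignment is marked for `φ` by
`x = y` or for `ψ` by `x ≠ y`, and the implications `x = y → φ` and `x ≠ y → ψ` pick out the two
parts. A one-element model cannot mark `ψ`, but its teams have at most one assignment, so a disjunct
`ψ` suffices there. Marking may overwrite variables of the domain and merge assignments.
`Form.Sat.of_refines`, locality and downward closure in one statement, absorbs this. -/

namespace BID

/-! ### Locality, downward closure and the empty team in dependence logic. -/

section Locality

variable {L : FirstOrder.Language.{u, v}} {M : Type w} {V V' : Finset ℕ}

theorem update_congr_of_erase {W : Finset ℕ} {x : ℕ} {f g : ℕ → M}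
    (h : ∀ i ∈ W.erase x, f i = g i) (a : M) :
    ∀ i ∈ W, Function.update f x a i = Function.update g x a i := by
  intro i hi
  by_cases hx : i = x
  · subst hx; simp
  · simp [hx, h i (Finset.mem_erase.2 ⟨hx, hi⟩)]

theorem realize_congr_of_varFinset [L.Structure M] (t : L.Term ℕ) {f g : ℕ → M}
    (h : ∀ i ∈ t.varFinset, f i = g i) : t.realize f = t.realize g := by
  induction t with
  | var i => exact h i (by simp [FirstOrder.Language.Term.varFinset])
  | func F ts ih =>
    simp only [FirstOrder.Language.Term.realize_func]
    congr 1
    funext j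
    refine ih j fun i hi => h i ?_
    simp only [FirstOrder.Language.Term.varFinset, Finset.mem_biUnion]
    exact ⟨j, Finset.mem_univ j, hi⟩

variable [Nonempty M]

/-- The extension of an assignment to all variables by an arbitrary value. -/
noncomputable def Assignment.total (s : Assignment M V) (i : ℕ) : M :=
  if h : i ∈ V then s ⟨i, h⟩ else Classical.arbitrary M

theorem Assignment.total_update (s : Assignment M V) (x : ℕ) (a : M) :
    (s.update x a).total = Function.update s.total x a := by
  funext i
  by_cases hi : i = x
  · subst hi
    simp [Assignment.total, Assignment.update]
  · simp [Assignment.total, Assignment.update, hi]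

/-- Every assignment of `X` agrees on `W` with an assignment of `X'`. -/
def Team.Refines (W : Finset ℕ) (X : Team M V) (X' : Team M V') : Prop :=
  ∀ s ∈ X, ∃ s' ∈ X', ∀ i ∈ W, s.total i = s'.total i

theorem Team.Refines.mono {W W' : Finset ℕ} (hW : W' ⊆ W) {X : Team M V} {X' : Team M V'}
    (h : Team.Refines W X X') : Team.Refines W' X X' := fun s hs => by
  obtain ⟨s', hs', h'⟩ := h s hs
  exact ⟨s', hs', fun i hi => h' i (hW hi)⟩

theorem Team.Refines.duplicate {W : Finset ℕ} {x : ℕ} {X : Team M V} {X' : Team M V'}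
    (h : Team.Refines (W.erase x) X X') :
    Team.Refines W (X.duplicate x) (X'.duplicate x) := by
  rintro _ ⟨s, hs, a, rfl⟩
  obtain ⟨s', hs', h'⟩ := h s hs
  refine ⟨_, ⟨s', hs', a, rfl⟩, ?_⟩
  rw [Assignment.total_update, Assignment.total_update]
  exact update_congr_of_erase h' a

/-- Each assignment of `X` copies the value that `F'` gives to a chosen partner in `X'`. -/
theorem Team.Refines.exists_supplement {W : Finset ℕ} {x : ℕ} {X : Team M V} {X' : Team M V'}
    (h : Team.Refines (W.erase x) X X') (F' : X' → M) :
    ∃ F : X → M, Team.Refines W (X.supplement x F) (X'.supplement x F') := by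
  choose g hg hagree using h
  refine ⟨fun s => F' ⟨g s.1 s.2, hg s.1 s.2⟩, ?_⟩
  rintro _ ⟨s, rfl⟩
  refine ⟨_, ⟨⟨g s.1 s.2, hg s.1 s.2⟩, rfl⟩, ?_⟩
  simp only [Assignment.total_update]
  exact update_congr_of_erase (hagree s.1 s.2) _

variable [L.Structure M]

theorem Assignment.val_congr {s : Assignment M V} {s' : Assignment M V'} {t : L.Term ℕ}
    (h : ∀ i ∈ t.varFinset, s.total i = s'.total i) : s.val t = s'.val t :=
  realize_congr_of_varFinset t h

theorem Assignment.val_var (s : Assignment M V) (i : ℕ) :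
    s.val (FirstOrder.Language.Term.var i : L.Term ℕ) = s.total i := rfl

theorem Atom.holds_congr {s : Assignment M V} {s' : Assignment M V'} (α : Atom L)
    (h : ∀ i ∈ α.vars, s.total i = s'.total i) : α.Holds s ↔ α.Holds s' := by
  cases α with
  | eq t₁ t₂ =>
    simp only [Atom.vars, Finset.mem_union] at h
    simp only [Atom.Holds]
    rw [Assignment.val_congr fun i hi => h i (Or.inl hi),
      Assignment.val_congr fun i hi => h i (Or.inr hi)]
  | rel R ts =>
    have hts : (fun j => s.val (ts j)) = fun j => s'.val (ts j) := funext fun j =>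
      Assignment.val_congr fun i hi =>
        h i (Finset.mem_biUnion.2 ⟨j, Finset.mem_univ j, hi⟩)
    simp only [Atom.Holds, hts]

theorem varFinset_subset_listVars {ts : List (L.Term ℕ)} {t : L.Term ℕ} (h : t ∈ ts) :
    t.varFinset ⊆ listVars ts := by
  induction ts with
  | nil => simp at h
  | cons r ts ih =>
    simp only [listVars]
    rcases List.mem_cons.1 h with rfl | h
    · exact Finset.subset_union_left
    · exact (ih h).trans Finset.subset_union_right

/-- Locality and downward closure of dependence logic. -/
theorem Form.Sat.of_refines {φ : Form L} (hD : φ.IsD) {V V' : Finset ℕ} {X : Team M V}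
    {X' : Team M V'} (h : Team.Refines φ.fv X X') (hX' : φ.Sat X') : φ.Sat X := by
  induction φ generalizing V V' with
  | atom α =>
    intro s hs
    obtain ⟨s', hs', h'⟩ := h s hs
    exact (α.holds_congr h').2 (hX' s' hs')
  | natom α =>
    intro s hs
    obtain ⟨s', hs', h'⟩ := h s hs
    exact fun hα => hX' s' hs' ((α.holds_congr h').1 hα)
  | dep ts t =>
    intro s hs r hr hsr
    obtain ⟨s', hs', h₁⟩ := h s hs
    obtain ⟨r', hr', h₂⟩ := h r hr
    simp only [Form.fv, Finset.mem_union] at h₁ h₂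
    rw [Assignment.val_congr fun i hi => h₁ i (Or.inr hi),
      Assignment.val_congr fun i hi => h₂ i (Or.inr hi)]
    refine hX' s' hs' r' hr' fun q hq => ?_
    rw [← Assignment.val_congr fun i hi => h₁ i (Or.inl (varFinset_subset_listVars hq hi)),
      ← Assignment.val_congr fun i hi => h₂ i (Or.inl (varFinset_subset_listVars hq hi))]
    exact hsr q hq
  | ndep ts t =>
    simp only [Form.Sat] at hX' ⊢
    subst hX'
    refine Set.eq_empty_of_forall_notMem fun s hs => ?_
    obtain ⟨s', hs', -⟩ := h s hs
    exact hs'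
  | conj φ ψ ihφ ihψ =>
    exact ⟨ihφ hD.1 (h.mono Finset.subset_union_left) hX'.1,
      ihψ hD.2 (h.mono Finset.subset_union_right) hX'.2⟩
  | split φ ψ ihφ ihψ =>
    obtain ⟨Y', Z', rfl, hY, hZ⟩ := hX'
    -- The parts may overlap: an assignment joins every part in which it has a partner.
    refine ⟨{s ∈ X | ∃ s' ∈ Y', ∀ i ∈ φ.fv ∪ ψ.fv, s.total i = s'.total i},
      {s ∈ X | ∃ s' ∈ Z', ∀ i ∈ φ.fv ∪ ψ.fv, s.total i = s'.total i}, ?_,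
      ihφ hD.1 (Team.Refines.mono Finset.subset_union_left fun s hs => hs.2) hY,
      ihψ hD.2 (Team.Refines.mono Finset.subset_union_right fun s hs => hs.2) hZ⟩
    ext s
    constructor
    · intro hs
      obtain ⟨s', hs' | hs', h'⟩ := h s hs
      · exact Or.inl ⟨hs, s', hs', h'⟩
      · exact Or.inr ⟨hs, s', hs', h'⟩
    · rintro (hs | hs) <;> exact hs.1
  | all x φ ih => exact ih hD h.duplicate hX'
  | ex x φ ih =>
    obtain ⟨F', hF'⟩ := hX'
    obtain ⟨F, hF⟩ := h.exists_supplement F'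
    exact ⟨F, ih hD hF hF'⟩
  | _ => exact hD.elim

theorem Form.sat_empty {φ : Form L} (hD : φ.IsD) (V : Finset ℕ) :
    φ.Sat (∅ : Team M V) := by
  induction φ generalizing V with
  | atom α => exact fun s hs => hs.elim
  | natom α => exact fun s hs => hs.elim
  | dep ts t => exact fun s hs => hs.elim
  | ndep ts t => exact rfl
  | conj φ ψ ihφ ihψ => exact ⟨ihφ hD.1 V, ihψ hD.2 V⟩
  | split φ ψ ihφ ihψ => exact ⟨∅, ∅, (Set.union_self _).symm, ihφ hD.1 V, ihψ hD.2 V⟩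
  | all x φ ih =>
    have : Team.duplicate (∅ : Team M V) x = ∅ := by simp [Team.duplicate]
    simpa only [Form.Sat, this] using ih hD _
  | ex x φ ih =>
    refine ⟨fun s => s.2.elim, ?_⟩
    rw [Team.supplement, Set.range_eq_empty]
    exact ih hD _
  | _ => exact hD.elim

end Locality

/-! ### Translation into intuitionistic dependence logic. -/

section Translation

variable {L : FirstOrder.Language.{u, v}}

theorem Form.sat_imp_bot_atom {M : Type w} [L.Structure M] [Nonempty M] {V : Finset ℕ}
    (α : Atom L) (X : Team M V) :
    (Form.imp (.atom α) .bot).Sat X ↔ ∀ s ∈ X, ¬ α.Holds s := by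
  constructor
  · intro h s hs hα
    have : ({s} : Team M V) = ∅ :=
      h {s} (Set.singleton_subset_iff.2 hs) fun r hr => by rwa [Set.mem_singleton_iff.1 hr]
    exact Set.singleton_ne_empty s this
  · intro h Y hYX hY
    exact Set.eq_empty_of_forall_notMem fun s hs => h s (hYX hs) (hY s hs)

/-- The conjunction of the constancy atoms of a list of terms. -/
def constAll : List (L.Term ℕ) → Form L
  -- `⊥ → ⊥` serves as truth.
  | [] => .imp .bot .bot
  | t :: ts => .conj (.dep [] t) (constAll ts)

theorem constAll_isID (ts : List (L.Term ℕ)) : (constAll ts).IsID := by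
  induction ts with
  | nil => exact ⟨trivial, trivial⟩
  | cons t ts ih => exact ⟨rfl, ih⟩

theorem constAll_fv (ts : List (L.Term ℕ)) : (constAll ts).fv = listVars ts := by
  induction ts with
  | nil => rfl
  | cons t ts ih => simp [constAll, Form.fv, listVars, ih]

theorem constAll_sat {M : Type w} [L.Structure M] [Nonempty M] {V : Finset ℕ}
    (ts : List (L.Term ℕ)) (X : Team M V) :
    (constAll ts).Sat X ↔ ∀ t ∈ ts, ∀ s ∈ X, ∀ s' ∈ X, s.val t = s'.val t := by
  induction ts with
  | nil => simp [constAll, Form.Sat]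
  | cons t ts ih => simp [constAll, Form.Sat, ih]

theorem sat_dep_iff {M : Type w} [L.Structure M] [Nonempty M] {V : Finset ℕ}
    (ts : List (L.Term ℕ)) (t : L.Term ℕ) (X : Team M V) :
    (Form.dep ts t).Sat X ↔ (Form.imp (constAll ts) (.dep [] t)).Sat X := by
  constructor
  · intro h Y hYX hY s hs s' hs' _
    rw [constAll_sat] at hY
    exact h s (hYX hs) s' (hYX hs') fun r hr => hY r hr s hs s' hs'
  · intro h s hs s' hs' hts
    -- On the pair `{s, s'}`, constancy of a term is just agreement of `s` and `s'` on it.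
    refine h {s, s'} (Set.pair_subset hs hs') ((constAll_sat _ _).2 ?_) s (by simp) s' (by simp)
      (by simp)
    rintro r hr q (rfl | rfl) q' (rfl | rfl)
    exacts [rfl, hts r hr, (hts r hr).symm, rfl]

/-- The atom `u = v` between two variables. -/
def varEq (L : FirstOrder.Language.{u, v}) (x y : ℕ) : Form L := .atom (.eq (.var x) (.var y))

/-- Splitting by marking each assignment with an equal or unequal pair of values of the
variables `x`, `y`; the second disjunct takes care of one-element models. -/
def splitID (x y : ℕ) (φ ψ : Form L) : Form L :=
  .idisj (.ex x (.ex y (.conj (.imp (varEq L x y) φ) (.imp (.imp (varEq L x y) .bot) ψ)))) ψ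

theorem splitID_fv_subset {x y : ℕ} {φ ψ : Form L} : (splitID x y φ ψ).fv ⊆ φ.fv ∪ ψ.fv := by
  intro i
  simp [splitID, varEq, Form.fv, Atom.vars, FirstOrder.Language.Term.varFinset]
  tauto

section

variable {M : Type w} [L.Structure M] [Nonempty M] {V : Finset ℕ} {x y : ℕ}

theorem sat_splitID_of_split (hxy : x ≠ y) {φ ψ φ' ψ' : Form L} (hφ : φ.IsD) (hψ : ψ.IsD)
    (hx : x ∉ φ.fv ∪ ψ.fv) (hy : y ∉ φ.fv ∪ ψ.fv)
    (hφ' : ∀ (V : Finset ℕ) (X : Team M V), φ.Sat X ↔ φ'.Sat X)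
    (hψ' : ∀ (V : Finset ℕ) (X : Team M V), ψ.Sat X ↔ ψ'.Sat X)
    {X : Team M V} (h : (Form.split φ ψ).Sat X) : (splitID x y φ' ψ').Sat X := by
  classical
  obtain ⟨Y, Z, rfl, hY, hZ⟩ := h
  rcases Y.eq_empty_or_nonempty with rfl | ⟨s₀, hs₀⟩
  -- With an empty `φ`-part no marking is needed; from here on `Y` is nonempty, which the
  -- one-element case relies on.
  · exact Or.inr (by rwa [Set.empty_union, ← hψ'])
  obtain ⟨a, b, hab⟩ : ∃ a b : M, a = b → Subsingleton M := by
    rcases subsingleton_or_nontrivial M with hM | hM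
    · exact ⟨Classical.arbitrary M, Classical.arbitrary M, fun _ => hM⟩
    · obtain ⟨a, b, hab⟩ := exists_pair_ne M
      exact ⟨a, b, fun h => (hab h).elim⟩
  have agree : ∀ {V : Finset ℕ} (s : Assignment M V) (c d : M), ∀ i ∈ φ.fv ∪ ψ.fv,
      ((s.update x c).update y d).total i = s.total i := by
    intro V s c d i hi
    have hix : i ≠ x := fun h => hx (h ▸ hi)
    have hiy : i ≠ y := fun h => hy (h ▸ hi)
    simp [Assignment.total_update, hix, hiy]
  have agree₁ : ∀ {V : Finset ℕ} (s : Assignment M V) (c : M), ∀ i ∈ φ.fv ∪ ψ.fv,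
      (s.update x c).total i = s.total i := by
    intro V s c i hi
    have hix : i ≠ x := fun h => hx (h ▸ hi)
    simp [Assignment.total_update, hix]
  -- The mark is `(a, a)` for `Y` and `(a, b)` otherwise. Since `s'` may have lost its old value at
  -- `x`, membership in `Y` is tested only up to agreement on the free variables.
  refine Or.inl ⟨fun _ => a, fun s' =>
    if ∃ r ∈ Y, ∀ i ∈ φ.fv ∪ ψ.fv, s'.1.total i = r.total i then a else b, ?_, ?_⟩
  · intro T hT hTeq
    refine (hφ' _ _).1 (Form.Sat.of_refines hφ (Team.Refines.mono Finset.subset_union_left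
      (W := φ.fv ∪ ψ.fv) fun s' hs' => ?_) hY)
    have heq := hTeq s' hs'
    obtain ⟨⟨_, ⟨⟨s, hs⟩, rfl⟩⟩, rfl⟩ := hT hs'
    simp only [Atom.Holds, Assignment.val_var, Assignment.total_update] at heq
    simp only [Function.update_self, ne_eq, hxy, not_false_eq_true, Function.update_of_ne] at heq
    split_ifs at heq with hr
    · obtain ⟨r, hrY, hr⟩ := hr
      refine ⟨r, hrY, fun i hi => ?_⟩
      rw [agree s _ _ i hi, ← hr i hi, ← Assignment.total_update, agree₁ s _ i hi]
    -- Here `a = b`, so the model has one element and every assignment agrees with `s₀ ∈ Y`.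
    · have := hab heq
      exact ⟨s₀, hs₀, fun i _ => Subsingleton.elim _ _⟩
  · intro T hT hTne
    rw [varEq, Form.sat_imp_bot_atom] at hTne
    refine (hψ' _ _).1 (Form.Sat.of_refines hψ (Team.Refines.mono Finset.subset_union_right
      (W := φ.fv ∪ ψ.fv) fun s' hs' => ?_) hZ)
    have hne := hTne s' hs'
    obtain ⟨⟨_, ⟨⟨s, hs⟩, rfl⟩⟩, rfl⟩ := hT hs'
    simp only [Atom.Holds, Assignment.val_var, Assignment.total_update] at hne
    simp only [Function.update_self, ne_eq, hxy, not_false_eq_true, Function.update_of_ne] at hne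
    rcases hs with hs | hs
    · refine absurd ?_ hne
      rw [if_pos]
      refine ⟨s, hs, fun i hi => ?_⟩
      rw [← agree₁ s a i hi, Assignment.total_update]
    · exact ⟨s, hs, agree s _ _⟩

theorem split_of_sat_splitID {φ ψ φ' ψ' : Form L} (hφ : φ.IsD) (hψ : ψ.IsD)
    (hx : x ∉ φ.fv ∪ ψ.fv) (hy : y ∉ φ.fv ∪ ψ.fv)
    (hφ' : ∀ (V : Finset ℕ) (X : Team M V), φ.Sat X ↔ φ'.Sat X)
    (hψ' : ∀ (V : Finset ℕ) (X : Team M V), ψ.Sat X ↔ ψ'.Sat X)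
    {X : Team M V} (h : (splitID x y φ' ψ').Sat X) : (Form.split φ ψ).Sat X := by
  rcases h with ⟨F, G, hl, hr⟩ | h
  -- `e s` is the marked version of `s`. As `e` need not be injective, `X` itself is split according
  -- to the mark of `e s`.
  · let e : X → Assignment M (insert y (insert x V)) := fun s =>
      (s.1.update x (F s)).update y (G ⟨_, s, rfl⟩)
    have he : ∀ s, e s ∈ Team.supplement (Team.supplement X x F) y G := fun s => ⟨_, rfl⟩
    have agree : ∀ s : X, ∀ i ∈ φ.fv ∪ ψ.fv, s.1.total i = (e s).total i := by
      intro s i hi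
      have hix : i ≠ x := fun h => hx (h ▸ hi)
      have hiy : i ≠ y := fun h => hy (h ▸ hi)
      simp [e, Assignment.total_update, hix, hiy]
    let α : Atom L := .eq (.var x) (.var y)
    refine ⟨Subtype.val '' {s : X | α.Holds (e s)}, Subtype.val '' {s : X | ¬ α.Holds (e s)},
      ?_, ?_, ?_⟩
    · rw [← Set.image_union]
      ext s
      by_cases hs : s ∈ X
      · simp [hs, em]
      · simp [hs]
    · refine Form.Sat.of_refines (X' := e '' {s : X | α.Holds (e s)}) hφ ?_
        ((hφ' _ _).2 (hl _ ?_ ?_))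
      · rintro _ ⟨s, hs, rfl⟩
        exact ⟨_, ⟨s, hs, rfl⟩, fun i hi => agree s i (Finset.mem_union_left _ hi)⟩
      · rintro _ ⟨s, -, rfl⟩
        exact he s
      · rintro _ ⟨s, hs, rfl⟩
        exact hs
    · refine Form.Sat.of_refines (X' := e '' {s : X | ¬ α.Holds (e s)}) hψ ?_
        ((hψ' _ _).2 (hr _ ?_ ?_))
      · rintro _ ⟨s, hs, rfl⟩
        exact ⟨_, ⟨s, hs, rfl⟩, fun i hi => agree s i (Finset.mem_union_right _ hi)⟩
      · rintro _ ⟨s, -, rfl⟩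
        exact he s
      · rw [varEq, Form.sat_imp_bot_atom]
        rintro _ ⟨s, hs, rfl⟩
        exact hs
  -- The extra disjunct is sound because the empty team satisfies `φ`.
  · exact ⟨∅, X, (Set.empty_union X).symm, Form.sat_empty hφ V, (hψ' _ _).2 h⟩

end

/-- Every formula of dependence logic is equivalent to one of intuitionistic dependence logic. -/
theorem exists_isID_equiv (φ : Form L) (hD : φ.IsD) :
    ∃ ψ : Form L, ψ.IsID ∧ ψ.fv ⊆ φ.fv ∧
      ∀ (M : Type w) [L.Structure M] [Nonempty M] (V : Finset ℕ) (X : Team M V),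
        φ.Sat X ↔ ψ.Sat X := by
  -- The equivalence puts no condition on `V`, since missing variables get a default value; the
  -- induction hypotheses thus apply to all supplemented and duplicated teams.
  induction φ with
  | atom α => exact ⟨.atom α, trivial, subset_rfl, fun M _ _ V X => Iff.rfl⟩
  | natom α =>
    exact ⟨.imp (.atom α) .bot, ⟨trivial, trivial⟩, by simp [Form.fv],
      fun M _ _ V X => (Form.sat_imp_bot_atom α X).symm⟩
  | dep ts t =>
    exact ⟨.imp (constAll ts) (.dep [] t), ⟨constAll_isID ts, rfl⟩,
      by simp [Form.fv, constAll_fv, listVars], fun M _ _ V X => sat_dep_iff ts t X⟩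
  | ndep ts t => exact ⟨.bot, trivial, Finset.empty_subset _, fun M _ _ V X => Iff.rfl⟩
  | conj φ ψ ihφ ihψ =>
    obtain ⟨φ', hφ, hfφ, eφ⟩ := ihφ hD.1
    obtain ⟨ψ', hψ, hfψ, eψ⟩ := ihψ hD.2
    exact ⟨.conj φ' ψ', ⟨hφ, hψ⟩, Finset.union_subset_union hfφ hfψ,
      fun M _ _ V X => and_congr (eφ M V X) (eψ M V X)⟩
  | split φ ψ ihφ ihψ =>
    obtain ⟨φ', hφ, hfφ, eφ⟩ := ihφ hD.1
    obtain ⟨ψ', hψ, hfψ, eψ⟩ := ihψ hD.2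
    -- The translation cannot depend on `V`, so `x` and `y` avoid only the free variables and may
    -- lie in the domain of the team.
    obtain ⟨x, hx⟩ := Infinite.exists_notMem_finset (φ.fv ∪ ψ.fv)
    obtain ⟨y, hy⟩ := Infinite.exists_notMem_finset (insert x (φ.fv ∪ ψ.fv))
    rw [Finset.mem_insert, not_or] at hy
    refine ⟨splitID x y φ' ψ',
      ⟨⟨⟨trivial, hφ⟩, ⟨trivial, trivial⟩, hψ⟩, hψ⟩,
      splitID_fv_subset.trans (Finset.union_subset_union hfφ hfψ), fun M _ _ V X => ?_⟩
    exact ⟨sat_splitID_of_split (Ne.symm hy.1) hD.1 hD.2 hx hy.2 (eφ M) (eψ M),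
      split_of_sat_splitID hD.1 hD.2 hx hy.2 (eφ M) (eψ M)⟩
  | all x φ ih =>
    obtain ⟨φ', hφ, hfφ, eφ⟩ := ih hD
    exact ⟨.all x φ', hφ, Finset.erase_subset_erase x hfφ, fun M _ _ V X => eφ M _ _⟩
  | ex x φ ih =>
    obtain ⟨φ', hφ, hfφ, eφ⟩ := ih hD
    exact ⟨.ex x φ', hφ, Finset.erase_subset_erase x hfφ,
      fun M _ _ V X => exists_congr fun F => eφ M _ _⟩
  | _ => exact hD.elim

end Translation

end BID

theorem mainTheorem6 (L : FirstOrder.Language.{u, v}) (φ : BID.Form L)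
    (hD : φ.IsD) (hs : φ.IsSentence) :
    ∃ ψ : BID.Form L, ψ.IsID ∧ ψ.IsSentence ∧ BID.LogEquiv.{u, v, w} φ ψ := by
  obtain ⟨ψ, hψ, hfv, h⟩ := BID.exists_isID_equiv.{u, v, w} φ hD
  refine ⟨ψ, hψ, Finset.subset_empty.1 (hfv.trans (Finset.subset_empty.2 hs)), ?_⟩
  intro M _ _ V _ X
  exact h M V X
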